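/- Let $\mathbb N=\{1,2,3,\dots\}$; for a set $M\subseteq\mathbb N$ let $[M]^{<\omega}$ be the set of finite subsets of $M$ and, for infinite $M$, let $[M]$ be the set of infinite subsets of $M$. For finite sets, $s<t$ means that every element of $s$ is smaller than every element of $t$, and $n\le s$ means that $n\le x$ for all $x\in s$. For a family $\mathcal L$ of finite subsets of $\mathbb N$, $\mathcal L^*$ is the set of all (possibly empty, not necessarily proper) initial segments of members of $\mathcal L$. **Uniform families.** For infinite $M\subseteq\mathbb N$, $\mathcal L\subseteq[M]^{<\omega}$ and $m\in M$ put $\mathcal L(m)=\{s\in[M]^{<\omega}:\{m\}\cup s\in\mathcal L,\ \{m\}<s\}$. $\mathcal L$ is $0$-uniform on $M$ if $\mathcal L=\{\emptyset\}$; it is $(\zeta+1)$-uniform on $M$ if $\emptyset\notin\mathcal L$ and $\mathcal L(m)$ is $\zeta$-uniform on $M\cap(m,\infty)$ for every $m\in M$; for a countable limit ordinal $\xi$ it is $\xi$-uniform on $M$ if $\emptyset\notin\mathcal L$ and there is a (not necessarily strictly) increasing family $(\xi_m)_{m\in M}$ of ordinals smaller than $\xi$ with $\sup_m\xi_m=\xi$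 such that $\mathcal L(m)$ is $\xi_m$-uniform on $M\cap(m,\infty)$ for every $m\in M$. **Schreier families.** Fix, for every countable limit ordinal $a$, a strictly increasing sequence $(a_n)_{n\in\mathbb N}$ of ordinals smaller than $a$ with $\sup_n a_n=a$. Define, for $a<\omega_1$, the families $\mathcal F_a$ and $\mathcal B_a$ of finite subsets of $\mathbb N$, both with these sequences, as follows. * $\mathcal F_0=\{\emptyset\}\cup\{\{n\}:n\in\mathbb N\}$; $\ \mathcal F_{a+1}$ is the set of all $\bigcup_{i=1}^nF_i$ with $n\in\mathbb N$, $F_i\in\mathcal F_a$, $n\le F_i$ for all $i$, and $F_i<F_j$ for $i<j$; for limit $a$, $\mathcal F_a=\{F: F\in\mathcal F_{a_n}\text{ for some } n\in\mathbb N\text{ with } n\le F\}$. * $\mathcal B_0=\{\{n\}:n\in\mathbb N\}$; $\ \mathcal B_{a+1}$ is the set of all $\bigcup_{i=1}^ns_i$ with $s_1<\dots<s_n$ in $\mathcal B_a$ and $n=\min s_1$; for limit $a$, $\mathcal B_a=\{s: s\in\mathcal B_{a_n}\text{ with }n=\min s\}$. For $L=\{\ell_1<\ell_2<\dots\}$ put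 $\mathcal F_a(L)=\{\{\ell_{n_1},\dots,\ell_{n_k}\}:\{n_1,\dots,n_k\}\in\mathcal F_a\}$. **Proposition 3.1 (with Corollary 3.2).** Let $\xi$ be a countable ordinal and $M$ an infinite subset of $\mathbb N$. 1. If $\mathcal L$ is an $\omega^\xi$-uniform family on $M$, then there is $L\in[M]$ with $\mathcal F_\xi(L)\subseteq\mathcal L^*$. 2. $(\mathcal B_\xi)^*\subseteq\mathcal F_\xi$. Moreover, suppose that the chosen sequences satisfy the following condition: for every countable limit ordinal $a$, the last term of the finite descending sequence $a,\ a_n,\ (a_n)_n,\dots$ (always take the $n$-th term of the chosen sequence, and stop at the first ordinal that is not a limit) tends to $a$ as $n\to\infty$. (This holds, for instance, if all $a_n$ are successor ordinals.) Then there is $L\in[M]$ with $\mathcal F_\xi(L)\subseteq(\mathcal B_\xi)^*\subseteq\mathcal F_\xi$. -/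

import Mathlib

/-! Families of finite subsets of the positive integers.  Here `ℕ+` is the set
`{1, 2, 3, …}` of natural numbers, a family is a `Set (Finset ℕ+)`, and an infinite subset of
`M` is handled as a strictly increasing sequence `ℓ : ℕ+ → ℕ+` with values in `M`. -/

/-- `s < t` for finite sets: every element of `s` is smaller than every element of `t`. -/
def FinBefore (s t : Finset ℕ+) : Prop := ∀ x ∈ s, ∀ y ∈ t, x < y

/-- `t` is an initial segment (possibly empty, possibly everything) of `s`. -/
def IsInitSeg (t s : Finset ℕ+) : Prop := t ⊆ s ∧ ∀ x ∈ s, ∀ y ∈ t, x ≤ y → x ∈ t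

/-- `𝓛*`: all initial segments of members of `𝓛`. -/
def initClosure (𝓛 : Set (Finset ℕ+)) : Set (Finset ℕ+) := {t | ∃ s ∈ 𝓛, IsInitSeg t s}

/-- `𝓛(m) = {s ∈ [M]^{<ω} : {m} ∪ s ∈ 𝓛 and {m} < s}`. -/
def sectionAt (M : Set ℕ+) (𝓛 : Set (Finset ℕ+)) (m : ℕ+) : Set (Finset ℕ+) :=
  {s | (∀ x ∈ s, x ∈ M) ∧ insert m s ∈ 𝓛 ∧ FinBefore {m} s}

/-- `IsUniform ξ M 𝓛`: `𝓛` is a family of finite subsets of `M` that is `ξ`-uniform on `M`. -/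
inductive IsUniform : Ordinal.{0} → Set ℕ+ → Set (Finset ℕ+) → Prop
  | zero (M : Set ℕ+) : IsUniform 0 M {∅}
  | succ (ζ : Ordinal.{0}) (M : Set ℕ+) (𝓛 : Set (Finset ℕ+))
      (hsub : ∀ s ∈ 𝓛, ∀ x ∈ s, x ∈ M) (hne : ∅ ∉ 𝓛)
      (h : ∀ m ∈ M, IsUniform ζ (M ∩ Set.Ioi m) (sectionAt M 𝓛 m)) :
      IsUniform (ζ + 1) M 𝓛
  | limit (ξ : Ordinal.{0}) (hξ : Order.IsSuccLimit ξ) (M : Set ℕ+) (𝓛 : Set (Finset ℕ+))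
      (hsub : ∀ s ∈ 𝓛, ∀ x ∈ s, x ∈ M) (hne : ∅ ∉ 𝓛)
      (a : ℕ+ → Ordinal.{0}) (ha_mono : MonotoneOn a M) (ha_lt : ∀ m ∈ M, a m < ξ)
      (ha_sup : IsLUB (a '' M) ξ)
      (h : ∀ m ∈ M, IsUniform (a m) (M ∩ Set.Ioi m) (sectionAt M 𝓛 m)) :
      IsUniform ξ M 𝓛

/-- A choice, for every countable limit ordinal `a`, of a strictly increasing sequence
`(c a n)` of ordinals smaller than `a` with supremum `a`. -/
def IsSequenceChoice (c : Ordinal.{0} → ℕ+ → Ordinal.{0}) : Prop :=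
  ∀ a : Ordinal.{0}, Order.IsSuccLimit a → a < Ordinal.omega 1 →
    StrictMono (c a) ∧ (∀ n, c a n < a) ∧ IsLUB (Set.range (c a)) a

/-- For every countable limit ordinal `a`, the last terms of the finite descending sequences
`a, a_n, (a_n)_n, …` (always take the `n`-th term of the chosen sequence, and stop at the first
ordinal that is not a limit) converge to `a` as `n → ∞`.  This holds, for instance, whenever all
terms of the chosen sequences are successor ordinals. -/
def IteratedChoiceConverges (c : Ordinal.{0} → ℕ+ → Ordinal.{0}) : Prop :=
  ∀ a : Ordinal.{0}, Order.IsSuccLimit a → a < Ordinal.omega 1 → ∀ b < a,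
    ∀ᶠ n : ℕ+ in Filter.atTop, ∀ e : Ordinal.{0},
      Relation.ReflTransGen (fun x y => Order.IsSuccLimit x ∧ y = c x n) a e → b ≤ e

/-- The generalized Schreier families `𝓕_ξ` for the choice `c` of sequences, with the empty set
counted as a member of each of them. -/
noncomputable def schreierF (c : Ordinal.{0} → ℕ+ → Ordinal.{0}) (ξ : Ordinal.{0}) :
    Set (Finset ℕ+) :=
  Ordinal.limitRecOn (motive := fun _ => Set (Finset ℕ+)) ξ
    {s | s = ∅ ∨ ∃ n : ℕ+, s = {n}}
    (fun _ 𝓕 => {s | ∃ (n : ℕ+) (G : Fin (n : ℕ) → Finset ℕ+),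
      (∀ i, G i ∈ 𝓕) ∧ (∀ i j, i < j → FinBefore (G i) (G j)) ∧
      (∀ i, ∀ x ∈ G i, n ≤ x) ∧ s = Finset.univ.biUnion G})
    (fun ξ _ 𝓕 => {s | ∃ (n : ℕ+) (h : c ξ n < ξ), s ∈ 𝓕 (c ξ n) h ∧ ∀ x ∈ s, n ≤ x})

/-- The uniform Schreier-type families `𝓑_a` for the choice `c` of sequences. -/
noncomputable def schreierB (c : Ordinal.{0} → ℕ+ → Ordinal.{0}) (a : Ordinal.{0}) :
    Set (Finset ℕ+) :=
  Ordinal.limitRecOn (motive := fun _ => Set (Finset ℕ+)) a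
    {s | ∃ n : ℕ+, s = {n}}
    (fun _ 𝓑 => {s | ∃ (n : ℕ+) (G : Fin (n : ℕ) → Finset ℕ+),
      (∀ i, G i ∈ 𝓑) ∧ (∀ i j, i < j → FinBefore (G i) (G j)) ∧
      IsLeast (↑(G ⟨0, n.pos⟩) : Set ℕ+) n ∧ s = Finset.univ.biUnion G})
    (fun a _ 𝓑 => {s | ∃ (n : ℕ+) (h : c a n < a), s ∈ 𝓑 (c a n) h ∧
      IsLeast (↑s : Set ℕ+) n})

/-- `𝓕(L) = {{ℓ_{n₁}, …, ℓ_{n_k}} : {n₁, …, n_k} ∈ 𝓕}` for `L = {ℓ₁ < ℓ₂ < …}`. -/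
def transfer (𝓕 : Set (Finset ℕ+)) (ℓ : ℕ+ → ℕ+) : Set (Finset ℕ+) :=
  {t | ∃ s ∈ 𝓕, t = s.image ℓ}

/-! The theorem is a comparison of ranks. A family of finite sets is read as a tree, in which
passing to `sectionBeyond 𝓖 k` goes up one level. `RankLE` bounds its rank from above; `RankGE`
bounds it from below, asking that the ranks of far-out sections eventually reach every smaller
ordinal.

If `𝓖` is spreading of rank at most `β` and `𝓛` has rank at least `β`, then `𝓖` embeds into `𝓛*`
(`RankGE.exists_transfer_subset`). The section of `𝓖` at `k` has some rank `γ < β`, so `ℓ k` can be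
chosen so far out that the section of `𝓛` at `ℓ k` has rank at least `γ`. Induction embeds section
into section; since `𝓖` is spreading, thinning preserves this, and one diagonal sequence serves all
`k`.

It remains to compute ranks: `𝓕_ξ` has rank at most `ω ^ ξ` (`rankLE_schreierF`), while `ω ^
ξ`-uniform families (`IsUniform.rankGE`) and, for convergent choices, `𝓑_ξ` (`rankGE_schreierB`)
have rank at least `ω ^ ξ`. Finally `(𝓑_ξ)* ⊆ 𝓕_ξ` because `𝓑_ξ ⊆ 𝓕_ξ` and `𝓕_ξ` is hereditary. -/

open Set

/-! ### Sections and unions of successive blocks. -/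

/-- The sets `s` lying beyond `k` for which `{k} ∪ s` belongs to `𝓖`. -/
def sectionBeyond (𝓖 : Set (Finset ℕ+)) (k : ℕ+) : Set (Finset ℕ+) :=
  {s | (∀ x ∈ s, k < x) ∧ insert k s ∈ 𝓖}

lemma sectionBeyond_mono {𝓖 𝓗 : Set (Finset ℕ+)} (h : 𝓖 ⊆ 𝓗) (k : ℕ+) :
    sectionBeyond 𝓖 k ⊆ sectionBeyond 𝓗 k := fun _ hs => ⟨hs.1, h hs.2⟩

lemma exists_mem_sectionBeyond {𝓖 : Set (Finset ℕ+)} {s : Finset ℕ+} (hs : s ∈ 𝓖)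
    (hne : s.Nonempty) : ∃ k, ∃ t ∈ sectionBeyond 𝓖 k, s = insert k t := by
  refine ⟨s.min' hne, s.erase (s.min' hne), ⟨fun x hx => ?_, ?_⟩, ?_⟩
  · exact Finset.min'_lt_of_mem_erase_min' s hne hx
  · rwa [Finset.insert_erase (s.min'_mem hne)]
  · rw [Finset.insert_erase (s.min'_mem hne)]

/-- All unions `s ∪ t` of successive sets `s ∈ 𝓖` and `t ∈ 𝓗`. -/
def concat (𝓖 𝓗 : Set (Finset ℕ+)) : Set (Finset ℕ+) :=
  {u | ∃ s ∈ 𝓖, ∃ t ∈ 𝓗, FinBefore s t ∧ u = s ∪ t}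

/-- All unions of `n` successive members of `𝓖`. -/
def blocks (𝓖 : Set (Finset ℕ+)) : ℕ → Set (Finset ℕ+)
  | 0 => {∅}
  | n + 1 => concat 𝓖 (blocks 𝓖 n)

lemma mem_blocks_iff {𝓖 : Set (Finset ℕ+)} {n : ℕ} {s : Finset ℕ+} :
    s ∈ blocks 𝓖 n ↔ ∃ G : Fin n → Finset ℕ+, (∀ i, G i ∈ 𝓖) ∧
      (∀ i j, i < j → FinBefore (G i) (G j)) ∧ s = Finset.univ.biUnion G := by
  induction n generalizing s with
  | zero => simp [blocks]
  | succ n ih =>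
    constructor
    · rintro ⟨x, hx, y, hy, hxy, rfl⟩
      obtain ⟨G, hG, hlt, rfl⟩ := ih.1 hy
      refine ⟨Fin.cons x G, fun i => ?_, fun i j => ?_, ?_⟩
      · refine Fin.cases ?_ (fun i => ?_) i
        · simpa using hx
        · simpa using hG i
      · refine Fin.cases ?_ (fun i => ?_) i <;> refine Fin.cases ?_ (fun j => ?_) j
        · intro h; exact absurd h (lt_irrefl _)
        · intro _ a ha b hb
          simp only [Fin.cons_zero, Fin.cons_succ] at ha hb
          exact hxy a ha b (Finset.mem_biUnion.2 ⟨j, Finset.mem_univ _, hb⟩)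
        · intro h; exact absurd h (Fin.not_lt_zero _)
        · intro h
          simpa using hlt i j (Fin.succ_lt_succ_iff.1 h)
      · ext a
        simp [Fin.exists_fin_succ]
    · rintro ⟨G, hG, hlt, rfl⟩
      refine ⟨G 0, hG 0, Finset.univ.biUnion fun i : Fin n => G i.succ,
        ih.2 ⟨_, fun i => hG _, fun i j h => hlt _ _ (Fin.succ_lt_succ_iff.2 h), rfl⟩,
        fun a ha b hb => ?_, ?_⟩
      · obtain ⟨j, -, hj⟩ := Finset.mem_biUnion.1 hb
        exact hlt 0 j.succ (Fin.succ_pos j) a ha b hj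
      · ext a
        simp [Fin.exists_fin_succ]

/-- Padding with empty blocks turns "at most `m` blocks" into "exactly `m`". -/
lemma blocks_mono_of_empty_mem {𝓖 : Set (Finset ℕ+)} (h : ∅ ∈ 𝓖) {n m : ℕ} (hnm : n ≤ m) :
    blocks 𝓖 n ⊆ blocks 𝓖 m := by
  induction hnm with
  | refl => exact subset_rfl
  | step _ ih =>
    exact fun s hs => ⟨∅, h, s, ih hs, fun x hx => by simp at hx, by simp⟩

/-- As `k` is the least element of the union, either it lies in the first block or the first block
is empty. -/
lemma sectionBeyond_concat_subset (𝓖 𝓗 : Set (Finset ℕ+)) (k : ℕ+) :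
    sectionBeyond (concat 𝓖 𝓗) k ⊆ concat (sectionBeyond 𝓖 k) 𝓗 ∪ sectionBeyond 𝓗 k := by
  rintro s ⟨hs, x, hx, y, hy, hxy, he⟩
  have hge : ∀ a ∈ x ∪ y, k ≤ a := by
    intro a ha
    rw [← he, Finset.mem_insert] at ha
    rcases ha with rfl | ha
    · exact le_rfl
    · exact (hs a ha).le
  have hks : k ∉ s := fun h => lt_irrefl _ (hs k h)
  by_cases hk : k ∈ x
  · left
    have hky : k ∉ y := fun h => lt_irrefl _ (hxy k hk k h)
    refine ⟨x.erase k, ⟨fun a ha => ?_, by rwa [Finset.insert_erase hk]⟩, y, hy,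
      fun a ha b hb => hxy a (Finset.mem_of_mem_erase ha) b hb, ?_⟩
    · exact lt_of_le_of_ne (hge a (Finset.mem_union_left _ (Finset.mem_of_mem_erase ha)))
        (Finset.ne_of_mem_erase ha).symm
    · rw [← Finset.erase_insert hks, he, Finset.erase_union_distrib,
        Finset.erase_eq_of_notMem hky]
  · right
    have hky : k ∈ y := by
      have : k ∈ x ∪ y := he ▸ Finset.mem_insert_self k s
      exact (Finset.mem_union.1 this).resolve_left hk
    have hx0 : x = ∅ := by
      refine Finset.eq_empty_of_forall_notMem fun a ha => ?_
      exact absurd (hge a (Finset.mem_union_left _ ha)) (not_le.2 (hxy a ha k hky))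
    refine ⟨hs, ?_⟩
    rw [he, hx0, Finset.empty_union]
    exact hy

/-! ### Upper bounds for the rank. -/

/-- The tree of the nonempty members of `𝓖`, ordered by initial segments, has rank at
most `β`. -/
inductive RankLE : Ordinal.{0} → Set (Finset ℕ+) → Prop
  | intro (β : Ordinal.{0}) (𝓖 : Set (Finset ℕ+)) (r : ℕ+ → Ordinal.{0})
      (hr : ∀ k, (sectionBeyond 𝓖 k).Nonempty → r k < β)
      (h : ∀ k, (sectionBeyond 𝓖 k).Nonempty → RankLE (r k) (sectionBeyond 𝓖 k)) :
      RankLE β 𝓖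

/-- `𝓖` is empty or has rank smaller than `β`. -/
def RankLT (β : Ordinal.{0}) (𝓖 : Set (Finset ℕ+)) : Prop :=
  𝓖.Nonempty → ∃ γ < β, RankLE γ 𝓖

lemma rankLE_iff {β : Ordinal.{0}} {𝓖 : Set (Finset ℕ+)} :
    RankLE β 𝓖 ↔ ∀ k, RankLT β (sectionBeyond 𝓖 k) := by
  constructor
  · rintro ⟨_, _, r, hr, h⟩ k hk
    exact ⟨r k, hr k hk, h k hk⟩
  · intro h
    choose! r hr using h
    exact ⟨_, _, r, fun k hk => (hr k hk).1, fun k hk => (hr k hk).2⟩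

lemma RankLT.trans_le {β γ : Ordinal.{0}} {𝓖 : Set (Finset ℕ+)} (h : RankLT β 𝓖)
    (hβ : β ≤ γ) : RankLT γ 𝓖 := fun hne =>
  let ⟨δ, hδ, h'⟩ := h hne
  ⟨δ, hδ.trans_le hβ, h'⟩

lemma RankLE.trans_le {β γ : Ordinal.{0}} {𝓖 : Set (Finset ℕ+)} (h : RankLE β 𝓖)
    (hβ : β ≤ γ) : RankLE γ 𝓖 :=
  rankLE_iff.2 fun k => (rankLE_iff.1 h k).trans_le hβ

lemma RankLE.mono {β : Ordinal.{0}} {𝓖 𝓗 : Set (Finset ℕ+)} (h : RankLE β 𝓖)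
    (hs : 𝓗 ⊆ 𝓖) : RankLE β 𝓗 := by
  induction h generalizing 𝓗 with
  | intro β 𝓖 r hr _ ih =>
    exact ⟨_, _, r, fun k hk => hr k (hk.mono (sectionBeyond_mono hs k)),
      fun k hk => ih k (hk.mono (sectionBeyond_mono hs k)) (sectionBeyond_mono hs k)⟩

lemma RankLT.mono {β : Ordinal.{0}} {𝓖 𝓗 : Set (Finset ℕ+)} (h : RankLT β 𝓖)
    (hs : 𝓗 ⊆ 𝓖) : RankLT β 𝓗 := fun hne =>
  let ⟨γ, hγ, h'⟩ := h (hne.mono hs)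
  ⟨γ, hγ, h'.mono hs⟩

/-- Sections of a union are unions of sections, so ranks combine by maximum and the bound does not
grow. -/
lemma RankLE.union {β : Ordinal.{0}} {𝓖 𝓗 : Set (Finset ℕ+)} (hG : RankLE β 𝓖)
    (hH : RankLE β 𝓗) : RankLE β (𝓖 ∪ 𝓗) := by
  induction β using WellFoundedLT.induction generalizing 𝓖 𝓗 with
  | ind β ih =>
  refine rankLE_iff.2 fun k hne => ?_
  have hsub : sectionBeyond (𝓖 ∪ 𝓗) k ⊆ sectionBeyond 𝓖 k ∪ sectionBeyond 𝓗 k :=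
    fun s hs => hs.2.imp (fun h => ⟨hs.1, h⟩) (fun h => ⟨hs.1, h⟩)
  by_cases h1 : (sectionBeyond 𝓖 k).Nonempty
  · obtain ⟨γ, hγ, hγ'⟩ := rankLE_iff.1 hG k h1
    by_cases h2 : (sectionBeyond 𝓗 k).Nonempty
    · obtain ⟨δ, hδ, hδ'⟩ := rankLE_iff.1 hH k h2
      exact ⟨max γ δ, max_lt hγ hδ, (ih _ (max_lt hγ hδ) (hγ'.trans_le (le_max_left _ _))
        (hδ'.trans_le (le_max_right _ _))).mono hsub⟩
    · rw [not_nonempty_iff_eq_empty] at h2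
      exact ⟨γ, hγ, hγ'.mono (by simpa [h2] using hsub)⟩
  · rw [not_nonempty_iff_eq_empty] at h1
    simp only [h1, empty_union] at hsub
    exact ((rankLE_iff.1 hH k).mono hsub) hne

lemma RankLT.union {β : Ordinal.{0}} {𝓖 𝓗 : Set (Finset ℕ+)} (hG : RankLT β 𝓖)
    (hH : RankLT β 𝓗) : RankLT β (𝓖 ∪ 𝓗) := by
  intro hne
  by_cases h1 : 𝓖.Nonempty
  · obtain ⟨γ, hγ, hγ'⟩ := hG h1
    by_cases h2 : 𝓗.Nonempty
    · obtain ⟨δ, hδ, hδ'⟩ := hH h2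
      exact ⟨max γ δ, max_lt hγ hδ, (hγ'.trans_le (le_max_left _ _)).union
        (hδ'.trans_le (le_max_right _ _))⟩
    · rw [not_nonempty_iff_eq_empty] at h2
      exact ⟨γ, hγ, by simpa [h2] using hγ'⟩
  · rw [not_nonempty_iff_eq_empty] at h1
    simp only [h1, empty_union] at hne ⊢
    exact hH hne

lemma RankLT.iUnion_le {β : Ordinal.{0}} {𝓖 : ℕ → Set (Finset ℕ+)} (h : ∀ n, RankLT β (𝓖 n))
    (k : ℕ) : RankLT β {s | ∃ n < k, s ∈ 𝓖 n} := by
  induction k with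
  | zero => rintro ⟨s, n, hn, -⟩; exact absurd hn (Nat.not_lt_zero n)
  | succ k ih =>
    refine (ih.union (h k)).mono ?_
    rintro s ⟨n, hn, hs⟩
    rcases Nat.lt_succ_iff_lt_or_eq.1 hn with hn | rfl
    · exact Or.inl ⟨n, hn, hs⟩
    · exact Or.inr hs

/-- The tree of `𝓗` is grafted onto the ends of `𝓖`; rank is counted from the leaves, so `β` comes
first in the sum. -/
lemma RankLE.concat {α β : Ordinal.{0}} {𝓖 𝓗 : Set (Finset ℕ+)} (hG : RankLE α 𝓖)
    (hH : RankLE β 𝓗) : RankLE (β + α) (concat 𝓖 𝓗) := by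
  induction hG with
  | intro α 𝓖 r hr _ ih =>
    refine rankLE_iff.2 fun k => RankLT.mono ?_ (sectionBeyond_concat_subset 𝓖 𝓗 k)
    refine RankLT.union ?_ ((rankLE_iff.1 hH k).trans_le le_self_add)
    rintro ⟨_, s, hs, -⟩
    exact ⟨β + r k, by gcongr; exact hr k ⟨s, hs⟩, ih k ⟨s, hs⟩⟩

lemma RankLE.blocks {β : Ordinal.{0}} {𝓖 : Set (Finset ℕ+)} (h : RankLE β 𝓖) (n : ℕ) :
    RankLE (β * n) (blocks 𝓖 n) := by
  induction n with
  | zero =>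
    refine rankLE_iff.2 fun k => ?_
    rintro ⟨s, -, hs⟩
    exact absurd hs (Finset.insert_ne_empty k s)
  | succ n ih =>
    rw [Nat.cast_succ, mul_add_one]
    exact h.concat ih

/-! ### Lower bounds for the rank. -/

/-- `𝓛` contains a family of rank at least `β` that meets the initial segments of every
infinite subset of a tail of `M`. -/
inductive RankGE (M : Set ℕ+) : Ordinal.{0} → Set (Finset ℕ+) → Prop
  | nil (𝓛 : Set (Finset ℕ+)) (h : ∅ ∈ 𝓛) : RankGE M 0 𝓛
  | step (β : Ordinal.{0}) (𝓛 : Set (Finset ℕ+)) (a : ℕ+ → Ordinal.{0}) (N : ℕ+)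
      (h : ∀ m ∈ M, N < m → RankGE M (a m) (sectionBeyond 𝓛 m))
      (ha : ∀ γ < β, ∃ K : ℕ+, ∀ m ∈ M, K < m → γ ≤ a m) : RankGE M β 𝓛

/-- Only large `m` are tested at each step, so `M` and `𝓛` matter only beyond a threshold `K`. -/
lemma RankGE.mono {M M' : Set ℕ+} {β : Ordinal.{0}} {𝓛 𝓛' : Set (Finset ℕ+)} (K : ℕ+)
    (h : RankGE M β 𝓛) (hM : ∀ m ∈ M', K < m → m ∈ M)
    (hL : ∀ s ∈ 𝓛, (∀ x ∈ s, K < x) → s ∈ 𝓛') : RankGE M' β 𝓛' := by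
  induction h generalizing 𝓛' with
  | nil 𝓛 h => exact .nil _ (hL ∅ h (by simp))
  | step β 𝓛 a N _ ha ih =>
    refine .step _ _ a (max N K) (fun m hm hlt => ?_) (fun γ hγ => ?_)
    · obtain ⟨h1, h2⟩ := max_lt_iff.1 hlt
      refine ih m (hM m hm h2) h1 fun s hs hK => ⟨hs.1, hL _ hs.2 ?_⟩
      intro x hx
      rcases Finset.mem_insert.1 hx with rfl | hx
      · exact h2
      · exact hK x hx
    · obtain ⟨K', hK'⟩ := ha γ hγ
      refine ⟨max K' K, fun m hm hlt => ?_⟩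
      obtain ⟨h1, h2⟩ := max_lt_iff.1 hlt
      exact hK' m (hM m hm h2) h1

lemma RankGE.mono_family {M : Set ℕ+} {β : Ordinal.{0}} {𝓛 𝓛' : Set (Finset ℕ+)}
    (h : RankGE M β 𝓛) (hL : 𝓛 ⊆ 𝓛') : RankGE M β 𝓛' :=
  h.mono 1 (fun _ hm _ => hm) (fun _ hs _ => hL hs)

lemma RankGE.of_le {M : Set ℕ+} {β γ : Ordinal.{0}} {𝓛 : Set (Finset ℕ+)}
    (h : RankGE M β 𝓛) (hγ : γ ≤ β) : RankGE M γ 𝓛 := by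
  cases h with
  | nil _ h => rw [nonpos_iff_eq_zero.1 hγ]; exact .nil _ h
  | step _ _ a N h ha => exact .step _ _ a N h fun δ hδ => ha δ (hδ.trans_le hγ)

lemma RankGE.concat {M : Set ℕ+} {α β : Ordinal.{0}} {𝓖 𝓗 : Set (Finset ℕ+)}
    (hG : RankGE M α 𝓖) (hH : RankGE M β 𝓗) : RankGE M (β + α) (concat 𝓖 𝓗) := by
  induction hG with
  | nil 𝓖 h =>
    rw [add_zero]
    exact hH.mono_family fun t ht => ⟨∅, h, t, ht, fun x hx => by simp at hx, by simp⟩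
  | step α 𝓖 a N _ ha ih =>
    refine .step _ _ (fun m => β + a m) N (fun m hm hlt => ?_) (fun γ hγ => ?_)
    · refine (ih m hm hlt).mono m (fun _ h _ => h) ?_
      rintro _ ⟨s, hs, t, ht, hst, rfl⟩ hgt
      refine ⟨hgt, insert m s, hs.2, t, ht, fun x hx y hy => ?_, (Finset.insert_union _ _ _).symm⟩
      rcases Finset.mem_insert.1 hx with rfl | hx
      · exact hgt y (Finset.mem_union_right _ hy)
      · exact hst x hx y hy
    · rcases lt_or_ge γ β with h | h
      · exact ⟨1, fun m _ _ => h.le.trans le_self_add⟩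
      · have hα : γ - β < α := by
          rwa [← add_lt_add_iff_left β, Ordinal.add_sub_cancel_of_le h]
        obtain ⟨K, hK⟩ := ha _ hα
        refine ⟨K, fun m hm hlt => ?_⟩
        rw [← Ordinal.add_sub_cancel_of_le h]
        gcongr
        exact hK m hm hlt

lemma RankGE.blocks {M : Set ℕ+} {β : Ordinal.{0}} {𝓖 : Set (Finset ℕ+)} (h : RankGE M β 𝓖)
    (n : ℕ) : RankGE M (β * n) (blocks 𝓖 n) := by
  induction n with
  | zero =>
    rw [Nat.cast_zero, mul_zero]
    exact .nil _ rfl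
  | succ n ih =>
    rw [Nat.cast_succ, mul_add_one]
    exact h.concat ih

lemma IsUniform.rankGE {β : Ordinal.{0}} {M : Set ℕ+} {𝓛 : Set (Finset ℕ+)}
    (h : IsUniform β M 𝓛) : RankGE M β 𝓛 := by
  have key : ∀ (M : Set ℕ+) (𝓛 : Set (Finset ℕ+)) (γ : Ordinal.{0}) (m : ℕ+),
      RankGE (M ∩ Ioi m) γ (sectionAt M 𝓛 m) → RankGE M γ (sectionBeyond 𝓛 m) :=
    fun M 𝓛 γ m h => h.mono m (fun x hx hlt => ⟨hx, hlt⟩)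
      fun s hs _ => ⟨fun x hx => hs.2.2 m (Finset.mem_singleton_self m) x hx, hs.2.1⟩
  induction h with
  | zero M => exact .nil _ rfl
  | succ ζ M 𝓛 _ _ _ ih =>
    exact .step _ _ (fun _ => ζ) 1 (fun m hm _ => key _ _ _ _ (ih m hm))
      fun γ hγ => ⟨1, fun _ _ _ => Order.lt_add_one_iff.1 hγ⟩
  | limit ξ _ M 𝓛 _ _ a ha_mono _ ha_sup _ ih =>
    refine .step _ _ a 1 (fun m hm _ => key _ _ _ _ (ih m hm)) fun γ hγ => ?_
    -- Monotonicity makes one index whose ordinal exceeds `γ` enough for all later ones.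
    obtain ⟨_, ⟨m, hm, rfl⟩, hlt, -⟩ := ha_sup.exists_between hγ
    exact ⟨m, fun x hx hmx => hlt.le.trans (ha_mono hm hx hmx.le)⟩

/-! ### Spreading families, diagonal sequences and the embedding. -/

/-- `𝓖` is stable under strictly increasing maps. -/
def IsSpreading (𝓖 : Set (Finset ℕ+)) : Prop :=
  ∀ φ : ℕ+ → ℕ+, StrictMono φ → ∀ s ∈ 𝓖, s.image φ ∈ 𝓖

/-- The modified map fixes `k`, so it sends `insert k s` to `insert k` of an image. -/
lemma strictMono_ite_id {φ : ℕ+ → ℕ+} {k : ℕ+} (hφ : StrictMonoOn φ (Ioi k))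
    (hk : ∀ x, k < x → k < φ x) : StrictMono fun x => if k < x then φ x else x := by
  intro x y hxy
  dsimp only
  split_ifs with h1 h2 h2
  · exact hφ h1 h2 hxy
  · exact absurd (h1.trans hxy) h2
  · exact (not_lt.1 h1).trans_lt (hk y h2)
  · exact hxy

lemma image_ite_id {φ : ℕ+ → ℕ+} {k : ℕ+} {s : Finset ℕ+} (hs : ∀ x ∈ s, k < x) :
    s.image (fun x => if k < x then φ x else x) = s.image φ :=
  Finset.image_congr fun x hx => if_pos (hs x hx)

/-- Only the values beyond `k` matter for the stability of the section at `k`. -/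
lemma IsSpreading.image_mem_sectionBeyond {𝓖 : Set (Finset ℕ+)} (h : IsSpreading 𝓖)
    {φ : ℕ+ → ℕ+} {k : ℕ+} (hφ : StrictMonoOn φ (Ioi k)) (hk : ∀ x, k < x → k < φ x)
    {s : Finset ℕ+} (hs : s ∈ sectionBeyond 𝓖 k) : s.image φ ∈ sectionBeyond 𝓖 k := by
  refine ⟨fun y hy => ?_, ?_⟩
  · obtain ⟨x, hx, rfl⟩ := Finset.mem_image.1 hy
    exact hk x (hs.1 x hx)
  · have := h _ (strictMono_ite_id hφ hk) _ hs.2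
    rwa [Finset.image_insert, image_ite_id hs.1, if_neg (lt_irrefl k)] at this

lemma IsSpreading.sectionBeyond {𝓖 : Set (Finset ℕ+)} (h : IsSpreading 𝓖) (k : ℕ+) :
    IsSpreading (sectionBeyond 𝓖 k) := fun _ hφ _ hs =>
  h.image_mem_sectionBeyond (hφ.strictMonoOn _) (fun _ hx => hx.trans_le (hφ.le_apply)) hs

lemma exists_strictMono_mem {M : Set ℕ+} (hM : M.Infinite) :
    ∃ ℓ : ℕ+ → ℕ+, StrictMono ℓ ∧ ∀ n, ℓ n ∈ M := by
  obtain ⟨f, hf, hfM⟩ := Filter.extraction_of_frequently_atTop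
    (P := fun n : ℕ => n.succPNat ∈ M) (by
      rw [Filter.frequently_atTop]
      intro a
      obtain ⟨b, hb, hab⟩ := hM.exists_gt a.succPNat
      refine ⟨b.natPred, ?_, by simpa using hb⟩
      rw [← Nat.succPNat_le_succPNat, PNat.succPNat_natPred]
      exact hab.le)
  refine ⟨fun n => (f n.natPred).succPNat, fun x y hxy => ?_, fun n => hfM _⟩
  exact Nat.succPNat_lt_succPNat.2 (hf (PNat.natPred_lt_natPred.2 hxy))

/-- Diagonal sequences: if from every infinite `A ⊆ M` one can choose the `k`-th term and an
infinite set of candidates for the later terms, then all these choices can be made at once. -/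
lemma exists_diagonal {M : Set ℕ+} (hM : M.Infinite) (P : ℕ+ → ℕ+ → Set ℕ+ → Prop)
    (h : ∀ k, ∀ A ⊆ M, A.Infinite → ∃ m ∈ A, ∃ B ⊆ A ∩ Ioi m, B.Infinite ∧ P k m B) :
    ∃ ℓ : ℕ+ → ℕ+, StrictMono ℓ ∧ (∀ n, ℓ n ∈ M) ∧
      ∀ k, ∃ B, P k (ℓ k) B ∧ ∀ j, k < j → ℓ j ∈ B := by
  choose! m hm B hB hBinf hP using h
  -- `S n` holds the candidates left after `n` choices.
  let S : ℕ → Set ℕ+ := fun n => n.rec M fun i A => B i.succPNat A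
  have hS : ∀ n, S n ⊆ M ∧ (S n).Infinite := by
    intro n
    induction n with
    | zero => exact ⟨subset_rfl, hM⟩
    | succ n ih =>
      exact ⟨(hB _ _ ih.1 ih.2).trans (inter_subset_left.trans ih.1), hBinf _ _ ih.1 ih.2⟩
  have hstep : ∀ n, S (n + 1) ⊆ S n ∩ Ioi (m n.succPNat (S n)) := fun n =>
    hB _ _ (hS n).1 (hS n).2
  have hanti : Antitone S := antitone_nat_of_succ_le fun n => (hstep n).trans inter_subset_left
  have hmem : ∀ n, m n.succPNat (S n) ∈ S n := fun n => hm _ _ (hS n).1 (hS n).2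
  have hmono : StrictMono fun n : ℕ => m n.succPNat (S n) :=
    strictMono_nat_of_lt_succ fun n => (hstep n (hmem (n + 1))).2
  refine ⟨fun k => m k.natPred.succPNat (S k.natPred),
    fun x y hxy => hmono (PNat.natPred_lt_natPred.2 hxy), fun n => (hS _).1 (hmem _),
    fun k => ⟨S (k.natPred + 1), ?_, fun j hj => ?_⟩⟩
  · have := hP k.natPred.succPNat _ (hS k.natPred).1 (hS k.natPred).2
    change P k (m k.natPred.succPNat _) (B k.natPred.succPNat _)
    rwa [PNat.succPNat_natPred] at this ⊢
  · exact hanti (Nat.succ_le_of_lt (PNat.natPred_lt_natPred.2 hj)) (hmem _)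

lemma isInitSeg_insert {k : ℕ+} {s t : Finset ℕ+} (h : IsInitSeg s t)
    (ht : ∀ x ∈ t, k < x) : IsInitSeg (insert k s) (insert k t) := by
  refine ⟨Finset.insert_subset_insert k h.1, fun x hx y hy hxy => ?_⟩
  rcases Finset.mem_insert.1 hx with rfl | hx'
  · exact Finset.mem_insert_self _ _
  rcases Finset.mem_insert.1 hy with rfl | hy'
  · exact absurd (ht x hx') (not_lt.2 hxy)
  · exact Finset.mem_insert_of_mem (h.2 x hx' y hy' hxy)

lemma insert_mem_initClosure {𝓛 : Set (Finset ℕ+)} {k : ℕ+} {s : Finset ℕ+}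
    (h : s ∈ initClosure (sectionBeyond 𝓛 k)) : insert k s ∈ initClosure 𝓛 :=
  let ⟨_, ht, hst⟩ := h
  ⟨_, ht.2, isInitSeg_insert hst ht.1⟩

lemma empty_mem_initClosure {𝓛 : Set (Finset ℕ+)} (h : 𝓛.Nonempty) : ∅ ∈ initClosure 𝓛 :=
  let ⟨s, hs⟩ := h
  ⟨s, hs, by simp [IsInitSeg]⟩

lemma RankGE.nonempty {M : Set ℕ+} (hM : M.Infinite) {β : Ordinal.{0}} {𝓛 : Set (Finset ℕ+)}
    (h : RankGE M β 𝓛) : 𝓛.Nonempty := by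
  induction h with
  | nil _ h => exact ⟨_, h⟩
  | step _ _ _ N _ _ ih =>
    obtain ⟨m, hm, hlt⟩ := hM.exists_gt N
    obtain ⟨s, hs⟩ := ih m hm hlt
    exact ⟨_, hs.2⟩

/-- A spreading family embeds, along some sequence in `M`, into the initial segments of any
family on `M` whose rank is not smaller. -/
theorem RankGE.exists_transfer_subset {M : Set ℕ+} {β : Ordinal.{0}} {𝓛 : Set (Finset ℕ+)}
    (h : RankGE M β 𝓛) {A : Set ℕ+} (hAM : A ⊆ M) (hA : A.Infinite) {𝓖 : Set (Finset ℕ+)}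
    (hG : IsSpreading 𝓖) (hGβ : RankLE β 𝓖) :
    ∃ ℓ : ℕ+ → ℕ+, StrictMono ℓ ∧ (∀ n, ℓ n ∈ A) ∧ transfer 𝓖 ℓ ⊆ initClosure 𝓛 := by
  induction h generalizing A 𝓖 with
  | nil 𝓛 h =>
    obtain ⟨ℓ, hℓ, hℓA⟩ := exists_strictMono_mem hA
    refine ⟨ℓ, hℓ, hℓA, ?_⟩
    rintro _ ⟨s, hs, rfl⟩
    rcases s.eq_empty_or_nonempty with rfl | hne
    · simpa using empty_mem_initClosure ⟨_, h⟩
    · obtain ⟨k, t, ht, -⟩ := exists_mem_sectionBeyond hs hne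
      obtain ⟨γ, hγ, -⟩ := rankLE_iff.1 hGβ k ⟨t, ht⟩
      exact absurd hγ not_lt_zero
  | step β 𝓛 a N h ha ih =>
    obtain ⟨ℓ, hℓ, hℓA, hP⟩ := exists_diagonal hA
      -- The later terms are still unknown when `B` is chosen, so every increasing `ψ` into `B` must
      -- be allowed.
      (fun k m B => ∀ ψ : ℕ+ → ℕ+, StrictMonoOn ψ (Ioi k) → (∀ x, k < x → ψ x ∈ B) →
        ∀ s ∈ sectionBeyond 𝓖 k, s.image ψ ∈ initClosure (sectionBeyond 𝓛 m)) (by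
      intro k C hCA hC
      by_cases hne : (sectionBeyond 𝓖 k).Nonempty
      · obtain ⟨γ, hγ, hγG⟩ := rankLE_iff.1 hGβ k hne
        obtain ⟨K, hK⟩ := ha γ hγ
        obtain ⟨m, hmC, hm⟩ := hC.exists_gt (max N K)
        obtain ⟨hNm, hKm⟩ := max_lt_iff.1 hm
        have hmM : m ∈ M := hAM (hCA hmC)
        have hCm : (C ∩ Ioi m).Infinite := by
          refine infinite_of_forall_exists_gt fun x => ?_
          obtain ⟨y, hy, hxy⟩ := hC.exists_gt (max x m)
          exact ⟨y, ⟨hy, (le_max_right _ _).trans_lt hxy⟩, (le_max_left _ _).trans_lt hxy⟩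
        obtain ⟨e, he, heC, hsub⟩ := ih m hmM hNm (A := C ∩ Ioi m)
          (inter_subset_left.trans (hCA.trans hAM)) hCm (hG.sectionBeyond k)
          (hγG.trans_le (hK m hmM hKm))
        -- Discarding `e x` for `x ≤ k` ensures that in `ψ = e ∘ φ` the map `φ` keeps `Ioi k` beyond
        -- `k`, as stability of the section demands.
        refine ⟨m, hmC, e '' Ioi k, ?_, (Ioi_infinite k).image he.injective.injOn, ?_⟩
        · rintro _ ⟨x, -, rfl⟩
          exact heC x
        · intro ψ hψ hψB s hs
          choose! φ hφ hφe using hψB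
          have hmono : StrictMonoOn φ (Ioi k) := fun x hx y hy hxy =>
            he.lt_iff_lt.1 (by rw [hφe x hx, hφe y hy]; exact hψ hx hy hxy)
          refine hsub ⟨s.image φ, hG.image_mem_sectionBeyond hmono hφ hs, ?_⟩
          rw [Finset.image_image]
          exact Finset.image_congr fun x hx => (hφe x (hs.1 x hx)).symm
      · obtain ⟨m, hmC⟩ := hC.nonempty
        refine ⟨m, hmC, C ∩ Ioi m, subset_rfl, ?_, fun _ _ _ s hs => absurd ⟨s, hs⟩ hne⟩
        refine infinite_of_forall_exists_gt fun x => ?_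
        obtain ⟨y, hy, hxy⟩ := hC.exists_gt (max x m)
        exact ⟨y, ⟨hy, (le_max_right _ _).trans_lt hxy⟩, (le_max_left _ _).trans_lt hxy⟩)
    refine ⟨ℓ, hℓ, hℓA, ?_⟩
    rintro _ ⟨s, hs, rfl⟩
    rcases s.eq_empty_or_nonempty with rfl | hne
    · simpa using empty_mem_initClosure ((RankGE.step β 𝓛 a N h ha).nonempty (hA.mono hAM))
    · obtain ⟨k, t, ht, rfl⟩ := exists_mem_sectionBeyond hs hne
      obtain ⟨B, hB, hlt⟩ := hP k
      rw [Finset.image_insert]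
      exact insert_mem_initClosure (hB ℓ (hℓ.strictMonoOn _) hlt t ht)

/-! ### Schreier families: structure and ranks. -/

section Schreier

variable {c : Ordinal.{0} → ℕ+ → Ordinal.{0}}

lemma mem_schreierF_zero {s : Finset ℕ+} :
    s ∈ schreierF c 0 ↔ s = ∅ ∨ ∃ n : ℕ+, s = {n} := by
  rw [schreierF, Ordinal.limitRecOn_zero]; rfl

lemma mem_schreierF_succ {a : Ordinal.{0}} {s : Finset ℕ+} :
    s ∈ schreierF c (a + 1) ↔ ∃ (n : ℕ+) (G : Fin (n : ℕ) → Finset ℕ+),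
      (∀ i, G i ∈ schreierF c a) ∧ (∀ i j, i < j → FinBefore (G i) (G j)) ∧
      (∀ i, ∀ x ∈ G i, n ≤ x) ∧ s = Finset.univ.biUnion G := by
  rw [schreierF, Ordinal.limitRecOn_add_one]; rfl

lemma mem_schreierF_limit {a : Ordinal.{0}} (ha : Order.IsSuccLimit a) {s : Finset ℕ+} :
    s ∈ schreierF c a ↔ ∃ n : ℕ+, c a n < a ∧ s ∈ schreierF c (c a n) ∧ ∀ x ∈ s, n ≤ x := by
  rw [schreierF, Ordinal.limitRecOn_limit _ _ _ _ ha]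
  exact exists_congr fun n => exists_prop

lemma mem_schreierB_zero {s : Finset ℕ+} :
    s ∈ schreierB c 0 ↔ ∃ n : ℕ+, s = {n} := by
  rw [schreierB, Ordinal.limitRecOn_zero]; rfl

lemma mem_schreierB_succ {a : Ordinal.{0}} {s : Finset ℕ+} :
    s ∈ schreierB c (a + 1) ↔ ∃ (n : ℕ+) (G : Fin (n : ℕ) → Finset ℕ+),
      (∀ i, G i ∈ schreierB c a) ∧ (∀ i j, i < j → FinBefore (G i) (G j)) ∧
      IsLeast (↑(G ⟨0, n.pos⟩) : Set ℕ+) n ∧ s = Finset.univ.biUnion G := by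
  rw [schreierB, Ordinal.limitRecOn_add_one]; rfl

lemma mem_schreierB_limit {a : Ordinal.{0}} (ha : Order.IsSuccLimit a) {s : Finset ℕ+} :
    s ∈ schreierB c a ↔
      ∃ n : ℕ+, c a n < a ∧ s ∈ schreierB c (c a n) ∧ IsLeast (↑s : Set ℕ+) n := by
  rw [schreierB, Ordinal.limitRecOn_limit _ _ _ _ ha]
  exact exists_congr fun n => exists_prop

lemma schreierF_mem_of_subset {a : Ordinal.{0}} {s t : Finset ℕ+} (hs : s ∈ schreierF c a)
    (hts : t ⊆ s) : t ∈ schreierF c a := by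
  induction a using Ordinal.limitRecOn generalizing s t with
  | zero =>
    rw [mem_schreierF_zero] at hs ⊢
    rcases hs with rfl | ⟨n, rfl⟩
    · exact Or.inl (Finset.subset_empty.1 hts)
    · exact (Finset.subset_singleton_iff.1 hts).imp_right fun h => ⟨n, h⟩
  | add_one a ih =>
    rw [mem_schreierF_succ] at hs ⊢
    obtain ⟨n, G, hG, hlt, hn, rfl⟩ := hs
    refine ⟨n, fun i => G i ∩ t, fun i => ih (hG i) Finset.inter_subset_left,
      fun i j hij x hx y hy => hlt i j hij x (Finset.mem_inter.1 hx).1 y (Finset.mem_inter.1 hy).1,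
      fun i x hx => hn i x (Finset.mem_inter.1 hx).1, ?_⟩
    rw [← Finset.biUnion_inter, Finset.inter_eq_right.2 hts]
  | limit a ha ih =>
    rw [mem_schreierF_limit ha] at hs ⊢
    obtain ⟨n, hlt, hs, hn⟩ := hs
    exact ⟨n, hlt, ih _ hlt hs hts, fun x hx => hn x (hts hx)⟩

lemma schreierB_subset_schreierF (a : Ordinal.{0}) : schreierB c a ⊆ schreierF c a := by
  induction a using Ordinal.limitRecOn with
  | zero => exact fun s hs => mem_schreierF_zero.2 (Or.inr (mem_schreierB_zero.1 hs))
  | add_one a ih =>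
    intro s hs
    obtain ⟨n, G, hG, hlt, hn, rfl⟩ := mem_schreierB_succ.1 hs
    refine mem_schreierF_succ.2 ⟨n, G, fun i => ih (hG i), hlt, fun i x hx => ?_, rfl⟩
    rcases eq_or_ne i ⟨0, n.pos⟩ with rfl | hi
    · exact hn.2 hx
    · have h0 : (⟨0, n.pos⟩ : Fin n) < i :=
        Fin.lt_def.2 (Nat.pos_of_ne_zero fun h => hi (Fin.ext h))
      exact (hlt _ i h0 n hn.1 x hx).le
  | limit a ha ih =>
    intro s hs
    obtain ⟨n, hlt, hs, hn⟩ := (mem_schreierB_limit ha).1 hs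
    exact (mem_schreierF_limit ha).2 ⟨n, hlt, ih _ hlt hs, fun x hx => hn.2 hx⟩

lemma isSpreading_schreierF (a : Ordinal.{0}) : IsSpreading (schreierF c a) := by
  intro φ hφ
  induction a using Ordinal.limitRecOn with
  | zero =>
    intro s hs
    rw [mem_schreierF_zero] at hs ⊢
    rcases hs with rfl | ⟨n, rfl⟩
    · exact Or.inl (by simp)
    · exact Or.inr ⟨φ n, by simp⟩
  | add_one a ih =>
    intro s hs
    rw [mem_schreierF_succ] at hs ⊢
    obtain ⟨n, G, hG, hlt, hn, rfl⟩ := hs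
    refine ⟨n, fun i => (G i).image φ, fun i => ih _ (hG i), fun i j hij x hx y hy => ?_,
      fun i x hx => ?_, Finset.biUnion_image⟩
    · obtain ⟨u, hu, rfl⟩ := Finset.mem_image.1 hx
      obtain ⟨v, hv, rfl⟩ := Finset.mem_image.1 hy
      exact hφ (hlt i j hij u hu v hv)
    · obtain ⟨u, hu, rfl⟩ := Finset.mem_image.1 hx
      exact (hn i u hu).trans hφ.le_apply
  | limit a ha ih =>
    intro s hs
    rw [mem_schreierF_limit ha] at hs ⊢
    obtain ⟨n, hlt, hs, hn⟩ := hs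
    refine ⟨n, hlt, ih _ hlt s hs, fun x hx => ?_⟩
    obtain ⟨u, hu, rfl⟩ := Finset.mem_image.1 hx
    exact (hn u hu).trans hφ.le_apply

lemma empty_mem_schreierF (hc : IsSequenceChoice c) {a : Ordinal.{0}}
    (ha : a < Ordinal.omega 1) : ∅ ∈ schreierF c a := by
  induction a using Ordinal.limitRecOn with
  | zero => exact mem_schreierF_zero.2 (Or.inl rfl)
  | add_one a ih =>
    exact mem_schreierF_succ.2 ⟨1, fun _ => ∅, fun _ => ih ((lt_add_one a).trans ha),
      by simp [FinBefore], by simp, by ext; simp⟩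
  | limit a hl ih =>
    have h := (hc a hl ha).2.1 1
    exact (mem_schreierF_limit hl).2 ⟨1, h, ih _ h (h.trans ha), by simp⟩

lemma rankLE_schreierF (hc : IsSequenceChoice c) {a : Ordinal.{0}}
    (ha : a < Ordinal.omega 1) : RankLE (Ordinal.omega0 ^ a) (schreierF c a) := by
  induction a using Ordinal.limitRecOn with
  | zero =>
    refine rankLE_iff.2 fun k _ => ⟨0, by simp, rankLE_iff.2 fun j => ?_⟩
    rintro ⟨s, hs, hjs⟩
    obtain ⟨hlt, hmem⟩ := hjs
    rcases mem_schreierF_zero.1 hmem with h | ⟨n, h⟩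
    · exact absurd h (Finset.insert_ne_empty _ _)
    · have h1 : k = n := by simpa [h] using Finset.mem_insert_self k (insert j s)
      have h2 : j = n := by
        simpa [h] using Finset.mem_insert_of_mem (a := j) (b := k) (Finset.mem_insert_self j s)
      exact absurd (hlt j (Finset.mem_insert_self _ _)) (by simp [h1, h2])
  | add_one a ih =>
    have ha' := (lt_add_one a).trans ha
    refine rankLE_iff.2 fun k => ?_
    -- A member with least element `k` has at most `k` blocks, so the section has rank below `ω ^ a
    -- * k`.
    refine ((rankLE_iff.1 ((ih ha').blocks k) k).trans_le
      (γ := Ordinal.omega0 ^ (a + 1)) ?_).mono ?_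
    · rw [Ordinal.opow_add, Ordinal.opow_one]
      gcongr
      exact (Ordinal.natCast_lt_omega0 _).le
    · rintro s ⟨hs, hmem⟩
      refine ⟨hs, ?_⟩
      obtain ⟨n, G, hG, hlt, hn, he⟩ := mem_schreierF_succ.1 hmem
      have hk : k ∈ Finset.univ.biUnion G := he ▸ Finset.mem_insert_self k s
      obtain ⟨i, -, hi⟩ := Finset.mem_biUnion.1 hk
      exact blocks_mono_of_empty_mem (empty_mem_schreierF hc ha') (PNat.coe_le_coe _ _ |>.2 (hn i k hi))
        (mem_blocks_iff.2 ⟨G, hG, hlt, he⟩)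
  | limit a hl ih =>
    refine rankLE_iff.2 fun k => ?_
    have hlt := (hc a hl ha).2.1
    -- A set containing `k` can only come from `c a n` with `n ≤ k`: finitely many families, whose
    -- ranks have a maximum below `ω ^ a`.
    refine (RankLT.iUnion_le (β := Ordinal.omega0 ^ a)
      (𝓖 := fun n => sectionBeyond (schreierF c (c a n.succPNat)) k) (fun n => ?_) k).mono ?_
    · refine (rankLE_iff.1 (ih _ (hlt _) ((hlt _).trans ha)) k).trans_le ?_
      exact Ordinal.opow_le_opow_right Ordinal.omega0_pos (hlt _).le
    · rintro s ⟨hs, hmem⟩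
      obtain ⟨n, -, hmem, hn⟩ := (mem_schreierF_limit hl).1 hmem
      refine ⟨n.natPred, ?_, hs, by simpa using hmem⟩
      have : (n : ℕ) ≤ k := hn k (Finset.mem_insert_self k s)
      have h2 := n.natPred_add_one
      omega

/-- Prolonging a member of `𝓑_a` that starts at `m` by `m - 1` further blocks. -/
lemma concat_blocks_subset_schreierB {a : Ordinal.{0}} {m : ℕ+} {s : Finset ℕ+}
    (hs : s ∈ concat (sectionBeyond (schreierB c a) m) (blocks (schreierB c a) m.natPred))
    (hgt : ∀ x ∈ s, m < x) : s ∈ sectionBeyond (schreierB c (a + 1)) m := by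
  obtain ⟨n, rfl⟩ : ∃ n : ℕ, m = n.succPNat := ⟨_, m.succPNat_natPred.symm⟩
  obtain ⟨x, hx, y, hy, hxy, rfl⟩ := hs
  rw [Nat.natPred_succPNat] at hy
  obtain ⟨G, hG, hlt, rfl⟩ := mem_blocks_iff.1 hy
  refine ⟨hgt, mem_schreierB_succ.2 ⟨n.succPNat,
    (Fin.cons (insert n.succPNat x) G : Fin (n + 1) → Finset ℕ+), fun i => ?_,
    fun i j => ?_, ⟨Finset.mem_insert_self _ _, fun z hz => ?_⟩, ?_⟩⟩
  · exact Fin.cases (motive := fun i : Fin (n + 1) =>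
      (Fin.cons (insert n.succPNat x) G : Fin (n + 1) → Finset ℕ+) i ∈ schreierB c a)
      hx.2 hG i
  · revert i j
    change ∀ i j : Fin (n + 1), _
    refine Fin.cases (Fin.cases (fun h => absurd h (lt_irrefl _)) fun j _ u hu v hv => ?_)
      fun i => Fin.cases (fun h => absurd h (Fin.not_lt_zero _)) fun j hij =>
        hlt i j (Fin.succ_lt_succ_iff.1 hij)
    have hv' : v ∈ Finset.univ.biUnion G := Finset.mem_biUnion.2 ⟨j, Finset.mem_univ _, hv⟩
    rcases Finset.mem_insert.1 hu with rfl | hu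
    · exact hgt v (Finset.mem_union_right _ hv')
    · exact hxy u hu v hv'
  · rcases Finset.mem_insert.1 (Finset.mem_coe.1 hz) with rfl | hz
    · exact le_rfl
    · exact (hx.1 z hz).le
  · change _ = (Finset.univ : Finset (Fin (n + 1))).biUnion _
    ext z
    simp [Fin.exists_fin_succ, or_assoc]

/-- The hypothesis on `γ` only guarantees that the first block can be completed; the other `m - 1`
blocks supply the rank. -/
lemma rankGE_sectionBeyond_schreierB_succ {a β γ : Ordinal.{0}} {m : ℕ+}
    (h : RankGE univ γ (sectionBeyond (schreierB c a) m)) (hβ : RankGE univ β (schreierB c a)) :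
    RankGE univ (β * m.natPred) (sectionBeyond (schreierB c (a + 1)) m) :=
  ((h.concat (hβ.blocks m.natPred)).of_le le_self_add).mono m (fun _ _ _ => mem_univ _)
    fun _ hs hgt => concat_blocks_subset_schreierB hs hgt

lemma sectionBeyond_schreierB_limit {a : Ordinal.{0}} (ha : Order.IsSuccLimit a) {m : ℕ+}
    (hlt : c a m < a) :
    sectionBeyond (schreierB c a) m = sectionBeyond (schreierB c (c a m)) m := by
  have hleast : ∀ s : Finset ℕ+, (∀ x ∈ s, m < x) →
      IsLeast (↑(insert m s) : Set ℕ+) m := by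
    intro s hs
    refine ⟨by simp, fun x hx => ?_⟩
    rcases Finset.mem_insert.1 (Finset.mem_coe.1 hx) with rfl | hx
    · exact le_rfl
    · exact (hs x hx).le
  ext s
  refine and_congr_right fun hs => ?_
  rw [mem_schreierB_limit ha]
  constructor
  · rintro ⟨n, -, h, hn⟩
    rwa [hn.unique (hleast s hs)] at h
  · exact fun h => ⟨m, hlt, h, hleast s hs⟩

lemma RankGE.zero_of_section {M : Set ℕ+} {𝓛 : Set (Finset ℕ+)}
    (h : ∀ m, RankGE M 0 (sectionBeyond 𝓛 m)) : RankGE M 0 𝓛 :=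
  .step _ _ (fun _ => 0) 1 (fun m _ _ => h m) fun _ hγ => absurd hγ not_lt_zero

lemma rankGE_zero_sectionBeyond_schreierB (hc : IsSequenceChoice c) {a : Ordinal.{0}}
    (ha : a < Ordinal.omega 1) (m : ℕ+) : RankGE univ 0 (sectionBeyond (schreierB c a) m) := by
  induction a using Ordinal.limitRecOn generalizing m with
  | zero => exact .nil _ ⟨by simp, mem_schreierB_zero.2 ⟨m, by simp⟩⟩
  | add_one a ih =>
    have ih' := ih ((lt_add_one a).trans ha)
    exact (rankGE_sectionBeyond_schreierB_succ (ih' m)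
      (RankGE.zero_of_section ih')).of_le zero_le
  | limit a hl ih =>
    have hlt := (hc a hl ha).2.1 m
    rw [sectionBeyond_schreierB_limit hl hlt]
    exact ih _ hlt (hlt.trans ha) m

/-- `RankGE` for `𝓑_{c a m}` says nothing about its particular section at `m`. Descending to a
non-limit `e` makes that section computable. -/
lemma exists_iteratedChoice (hc : IsSequenceChoice c) {a : Ordinal.{0}}
    (ha : a < Ordinal.omega 1) (m : ℕ+) :
    ∃ e ≤ a, Relation.ReflTransGen (fun x y => Order.IsSuccLimit x ∧ y = c x m) a e ∧
      ¬ Order.IsSuccLimit e ∧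
      sectionBeyond (schreierB c a) m = sectionBeyond (schreierB c e) m := by
  induction a using WellFoundedLT.induction with
  | ind a ih =>
  by_cases hl : Order.IsSuccLimit a
  · have hlt := (hc a hl ha).2.1 m
    obtain ⟨e, hea, hrel, he, hsec⟩ := ih _ hlt (hlt.trans ha)
    exact ⟨e, hea.trans hlt.le, hrel.head ⟨hl, rfl⟩, he,
      (sectionBeyond_schreierB_limit hl hlt).trans hsec⟩
  · exact ⟨a, le_rfl, .refl, hl, rfl⟩

lemma rankGE_schreierB (hc : IsSequenceChoice c) (hconv : IteratedChoiceConverges c)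
    {a : Ordinal.{0}} (ha : a < Ordinal.omega 1) :
    RankGE univ (Ordinal.omega0 ^ a) (schreierB c a) := by
  induction a using Ordinal.limitRecOn with
  | zero =>
    refine .step _ _ (fun _ => 0) 1
      (fun m _ _ => rankGE_zero_sectionBeyond_schreierB hc ha m) fun γ hγ => ⟨1, ?_⟩
    simp only [Ordinal.opow_zero, Order.lt_one_iff] at hγ
    simp [hγ]
  | add_one a ih =>
    have ha' := (lt_add_one a).trans ha
    refine .step _ _ (fun m => Ordinal.omega0 ^ a * m.natPred) 1
      (fun m _ _ => rankGE_sectionBeyond_schreierB_succ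
        (rankGE_zero_sectionBeyond_schreierB hc ha' m) (ih ha')) fun γ hγ => ?_
    rw [Ordinal.opow_add, Ordinal.opow_one,
      Ordinal.lt_mul_iff_of_isSuccLimit Ordinal.isSuccLimit_omega0] at hγ
    obtain ⟨b, hb, hγ⟩ := hγ
    obtain ⟨n, rfl⟩ := Ordinal.lt_omega0.1 hb
    refine ⟨n.succPNat, fun m _ hm => hγ.le.trans ?_⟩
    gcongr
    rw [← Nat.succPNat_le_succPNat, PNat.succPNat_natPred]
    exact hm.le
  | limit a hl ih =>
    have hmain : ∀ m : ℕ+, ∃ γ, RankGE univ γ (sectionBeyond (schreierB c a) m) ∧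
        ∀ b < a, 1 < m → (∀ e, Relation.ReflTransGen
          (fun x y => Order.IsSuccLimit x ∧ y = c x m) a e → b + 1 ≤ e) →
          Ordinal.omega0 ^ b ≤ γ := by
      intro m
      obtain ⟨e, hea, hrel, he, hsec⟩ := exists_iteratedChoice hc ha m
      rw [hsec]
      rcases Ordinal.zero_or_succ_or_isSuccLimit e with rfl | ⟨d, rfl⟩ | h
      · refine ⟨0, rankGE_zero_sectionBeyond_schreierB hc (hea.trans_lt ha) m, ?_⟩
        intro b _ _ hb
        exact absurd (hb 0 hrel) (by simp)
      · have hd : d < a := (Order.lt_add_one_iff.2 le_rfl).trans_le hea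
        refine ⟨_, rankGE_sectionBeyond_schreierB_succ
          (rankGE_zero_sectionBeyond_schreierB hc (hd.trans ha) m) (ih d hd (hd.trans ha)), ?_⟩
        intro b _ hm hb
        have hbd : b ≤ d := by simpa using hb _ hrel
        -- For `m = 1` the factor `m - 1` vanishes, whence `1 < m`.
        have hpos : 1 ≤ m.natPred := PNat.natPred_lt_natPred.2 hm
        calc Ordinal.omega0 ^ b ≤ Ordinal.omega0 ^ d * (1 : ℕ) := by
              rw [Nat.cast_one, mul_one]
              exact Ordinal.opow_le_opow_right Ordinal.omega0_pos hbd
          _ ≤ Ordinal.omega0 ^ d * m.natPred := by gcongr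
      · exact absurd h he
    choose r hr hle using hmain
    refine .step _ _ r 1 (fun m _ _ => hr m) fun γ hγ => ?_
    obtain ⟨b, hb, hγ⟩ := (Ordinal.lt_opow_of_isSuccLimit Ordinal.omega0_ne_zero hl).1 hγ
    -- With `b + 1` in place of `b`, the terminal ordinal `d + 1` satisfies `b ≤ d`.
    obtain ⟨K, hK⟩ := Filter.eventually_atTop.1 (hconv a hl ha (b + 1) (hl.add_one_lt hb))
    exact ⟨K, fun m _ hm => hγ.le.trans
      (hle m b hb ((one_le (a := K)).trans_lt hm) (hK m hm.le))⟩

end Schreier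

theorem proposition3p1 (c : Ordinal.{0} → ℕ+ → Ordinal.{0}) (hc : IsSequenceChoice c)
    (ξ : Ordinal.{0}) (hξ : ξ < Ordinal.omega 1) (M : Set ℕ+) (hM : M.Infinite) :
    (∀ 𝓛 : Set (Finset ℕ+), IsUniform (Ordinal.omega0 ^ ξ) M 𝓛 →
      ∃ ℓ : ℕ+ → ℕ+, StrictMono ℓ ∧ (∀ n, ℓ n ∈ M) ∧
        transfer (schreierF c ξ) ℓ ⊆ initClosure 𝓛) ∧
    (IteratedChoiceConverges c →
      ∃ ℓ : ℕ+ → ℕ+, StrictMono ℓ ∧ (∀ n, ℓ n ∈ M) ∧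
        transfer (schreierF c ξ) ℓ ⊆ initClosure (schreierB c ξ)) ∧
    initClosure (schreierB c ξ) ⊆ schreierF c ξ := by
  refine ⟨fun 𝓛 h𝓛 => ?_, fun hconv => ?_, ?_⟩
  · exact h𝓛.rankGE.exists_transfer_subset Subset.rfl hM (isSpreading_schreierF ξ)
      (rankLE_schreierF hc hξ)
  · exact (rankGE_schreierB hc hconv hξ).exists_transfer_subset (subset_univ M) hM
      (isSpreading_schreierF ξ) (rankLE_schreierF hc hξ)
  · rintro t ⟨s, hs, hts⟩
    exact schreierF_mem_of_subset (schreierB_subset_schreierF ξ hs) hts.1
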